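/- A continuum is a nonempty compact connected metrizable space. For a continuum $X$ let $\operatorname{Cont}(X)$ be the space of all subcontinua of $X$ (including singletons and $X$) with the Vietoris topology. A continuum is indecomposable if it is not the union of two proper subcontinua, and $X$ is hereditarily indecomposable if every subcontinuum of $X$ is indecomposable. A maximal order arc is a subcontinuum $\mathcal C$ of $\operatorname{Cont}(X)$ that is linearly ordered by inclusion, contains $X$, and contains $\{x\}$ for some $x\in X$; the space $\operatorname{MOA}(X)$ of all maximal order arcs carries the subspace topology from $\operatorname{Cont}(\operatorname{Cont}(X))$. We write $K\simeq X$ if $K$ is homeomorphic to $X$. $X$ is GHEC if $\{K\in\operatorname{Cont}(X) : K\simeq X\}$ is comeager in $\operatorname{Cont}(X)$. GCGHEC holds for $X$ if the set of those $\mathcal C\in\operatorname{MOA}(X)$ for which $$\{C\in\mathcal C : C \text{ is degenerate or } C\simeq X\}$$ is comeager in $\mathcal C$ is comeager in $\operatorname{MOA}(X)$. Proposition. Let $X$ be a hereditarily indecomposable continuum, and let $\mathcal Z=\{(\mathcal C,K) : \mathcal C\in\operatorname{MOA}(X),\ K\in\mathcal C\}\subseteq\operatorname{MOA}(X)\times\operatorname{Cont}(X)$.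 (1) For every dense subset $O$ of $\operatorname{Cont}(X)$, the set $\{(\mathcal C,K)\in\mathcal Z : K\in O\}$ is dense in $\mathcal Z$. (2) If $X$ is GHEC, then GCGHEC holds for $X$. -/

import Mathlib

open Set Filter Topology TopologicalSpace

/-- The hyperspace `Cont(X)`: nonempty compact connected subsets of `X`, a subspace of the
space of nonempty compact subsets of `X` with the Vietoris topology. -/
def Subcontinua (X : Type*) [TopologicalSpace X] : Type _ :=
  {K : NonemptyCompacts X // IsConnected (K : Set X)}

namespace Subcontinua

variable {X : Type*} [TopologicalSpace X]

instance : TopologicalSpace (Subcontinua X) :=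
  inferInstanceAs (TopologicalSpace {K : NonemptyCompacts X // IsConnected (K : Set X)})

instance : SetLike (Subcontinua X) X where
  coe K := (K.1 : Set X)
  coe_injective _ _ h := Subtype.ext (SetLike.coe_injective h)

/-- `K` is not the union of two proper subcontinua. -/
def IsIndecomposable (K : Subcontinua X) : Prop :=
  ¬ ∃ A B : Subcontinua X,
    (A : Set X) ⊂ K ∧ (B : Set X) ⊂ K ∧ (K : Set X) = (A : Set X) ∪ (B : Set X)

end Subcontinua

/-- Every subcontinuum of `X` is indecomposable. -/
def IsHereditarilyIndecomposable (X : Type*) [TopologicalSpace X] : Prop :=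
  ∀ K : Subcontinua X, K.IsIndecomposable

/-- An order arc in `Cont(X)`: a continuum `𝒞 ⊆ Cont(X)` linearly ordered by inclusion. -/
def IsOrderArc {X : Type*} [TopologicalSpace X] (𝒞 : Subcontinua (Subcontinua X)) : Prop :=
  ∀ K₁ ∈ 𝒞, ∀ K₂ ∈ 𝒞, (K₁ : Set X) ⊆ K₂ ∨ (K₂ : Set X) ⊆ K₁

/-- An order arc is maximal if it contains `X` and some singleton `{x}`. -/
def IsMaximalOrderArc {X : Type*} [TopologicalSpace X] (𝒞 : Subcontinua (Subcontinua X)) : Prop :=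
  IsOrderArc 𝒞 ∧ (∃ K ∈ 𝒞, (K : Set X) = univ) ∧ ∃ x : X, ∃ K ∈ 𝒞, (K : Set X) = {x}

/-- The space `MOA(X)` of maximal order arcs, as a subspace of `Cont(Cont(X))`. -/
def MOA (X : Type*) [TopologicalSpace X] : Type _ :=
  {𝒞 : Subcontinua (Subcontinua X) // IsMaximalOrderArc 𝒞}

namespace MOA

variable {X : Type*} [TopologicalSpace X]

instance : TopologicalSpace (MOA X) :=
  inferInstanceAs (TopologicalSpace {𝒞 : Subcontinua (Subcontinua X) // IsMaximalOrderArc 𝒞})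

instance : SetLike (MOA X) (Subcontinua X) where
  coe 𝒞 := (𝒞.1 : Set (Subcontinua X))
  coe_injective _ _ h := Subtype.ext (SetLike.coe_injective h)

end MOA

/-- Generically hereditarily equivalent: comeager many subcontinua are homeomorphic to `X`. -/
def GHEC (X : Type*) [TopologicalSpace X] : Prop :=
  {K : Subcontinua X | Nonempty (K ≃ₜ X)} ∈ residual (Subcontinua X)

/-- For comeager many maximal order arcs `𝒞`, comeager many `C ∈ 𝒞` (in the subspace topology
of `𝒞`) are, if nondegenerate, homeomorphic to `X`. -/
def GCGHEC (X : Type*) [TopologicalSpace X] : Prop :=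
  {𝒞 : MOA X | {C : 𝒞 | Nontrivial C.1 → Nonempty (C.1 ≃ₜ X)} ∈ residual 𝒞} ∈ residual (MOA X)

/-- The set of pairs `(𝒞, K)` with `𝒞` a maximal order arc and `K ∈ 𝒞`, a subspace of
`MOA(X) × Cont(X)`. -/
def MOAIncidence (X : Type*) [TopologicalSpace X] : Set (MOA X × Subcontinua X) :=
  {p | p.2 ∈ p.1}

/-! ### Hyperspaces of subcontinua and boundary bumping -/

namespace Subcontinua

variable {X : Type*} [TopologicalSpace X]

/-! Two subcontinua of `X` that meet are comparable, since otherwise their union would be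
decomposable. So the subcontinua through a point `x` form a closed chain, connected by boundary
bumping, and every maximal order arc is such a chain (`IsOrderArc.coe_eq`). Hence `MOA.through` maps
`X` continuously onto `MOA X`. For (1), let `K` lie in an open `V` and in the arc through `x`, with
that arc in an open `𝒰`. The members of `V` that meet the open set of points `y` whose arc lies in
`𝒰` form a neighbourhood of `K`, so one of them is in `O`. For (2), a Kuratowski–Ulam argument: by
(1), for `O` open dense and `V` basic open, the arcs meeting `V ∩ O` are open and dense among those
meeting `V`. Intersect over countably many `V` and `O`. -/

theorem isClosed_setOf_isConnected [T2Space X] :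
    IsClosed {K : NonemptyCompacts X | IsConnected (K : Set X)} := by
  rw [← isOpen_compl_iff, isOpen_iff_forall_mem_open]
  intro K hK
  have hK' : ¬ IsPreconnected (K : Set X) := fun h => hK ⟨K.nonempty, h⟩
  rw [isPreconnected_iff_subset_of_fully_disjoint_closed K.isCompact.isClosed] at hK'
  push Not at hK'
  obtain ⟨u, v, hu, hv, huv, hd, hKu, hKv⟩ := hK'
  obtain ⟨U, V, hU, hV, hKU, hKV, hUV⟩ := SeparatedNhds.of_isCompact_isCompact
    (K.isCompact.inter_right hu) (K.isCompact.inter_right hv)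
    (hd.mono inter_subset_right inter_subset_right)
  obtain ⟨a, haK, hau⟩ := not_subset.1 hKu
  obtain ⟨b, hbK, hbv⟩ := not_subset.1 hKv
  refine ⟨{L | (L : Set X) ⊆ U ∪ V} ∩ ({L | ((L : Set X) ∩ U).Nonempty} ∩
      {L | ((L : Set X) ∩ V).Nonempty}), ?_,
    (NonemptyCompacts.isOpen_subsets_of_isOpen (hU.union hV)).inter
      ((NonemptyCompacts.isOpen_inter_nonempty_of_isOpen hU).inter
        (NonemptyCompacts.isOpen_inter_nonempty_of_isOpen hV)), ?_, ?_, ?_⟩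
  · rintro L ⟨h₁, h₂, h₃⟩ hL
    obtain ⟨x, -, hxU, hxV⟩ := hL.isPreconnected U V hU hV h₁ h₂ h₃
    exact hUV.notMem_of_mem_left hxU hxV
  · intro x hx
    exact (huv hx).imp (fun h => hKU ⟨hx, h⟩) (fun h => hKV ⟨hx, h⟩)
  · exact ⟨b, hbK, hKU ⟨hbK, (huv hbK).resolve_right hbv⟩⟩
  · exact ⟨a, haK, hKV ⟨haK, (huv haK).resolve_left hau⟩⟩

instance [T2Space X] : T2Space (Subcontinua X) :=
  inferInstanceAs (T2Space {K : NonemptyCompacts X // IsConnected (K : Set X)})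

instance [T2Space X] [CompactSpace X] : CompactSpace (Subcontinua X) :=
  isCompact_iff_compactSpace.1 (isClosed_setOf_isConnected (X := X)).isCompact

instance [SecondCountableTopology X] : SecondCountableTopology (Subcontinua X) :=
  TopologicalSpace.Subtype.secondCountableTopology
    {K : NonemptyCompacts X | IsConnected (K : Set X)}

theorem isConnected (K : Subcontinua X) : IsConnected (K : Set X) := K.2

theorem isCompact (K : Subcontinua X) : IsCompact (K : Set X) := K.1.isCompact

theorem isOpen_inter_nonempty {U : Set X} (hU : IsOpen U) :
    IsOpen {K : Subcontinua X | ((K : Set X) ∩ U).Nonempty} :=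
  (NonemptyCompacts.isOpen_inter_nonempty_of_isOpen hU).preimage continuous_subtype_val

theorem isOpen_subset {U : Set X} (hU : IsOpen U) :
    IsOpen {K : Subcontinua X | (K : Set X) ⊆ U} :=
  (NonemptyCompacts.isOpen_subsets_of_isOpen hU).preimage continuous_subtype_val

/-- The nonempty compact connected set `s` as a subcontinuum. -/
def mk' (s : Set X) (hc : IsCompact s) (hs : IsConnected s) : Subcontinua X :=
  ⟨⟨⟨s, hc⟩, hs.nonempty⟩, hs⟩

/-- The degenerate subcontinuum `{x}`. -/
def single (x : X) : Subcontinua X := mk' {x} isCompact_singleton isConnected_singleton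

theorem continuous_single : Continuous (single : X → Subcontinua X) :=
  NonemptyCompacts.continuous_singleton.subtype_mk _

theorem isClosed_mem [T2Space X] : IsClosed {p : X × Subcontinua X | p.1 ∈ p.2} := by
  rw [← isOpen_compl_iff, isOpen_iff_forall_mem_open]
  rintro ⟨x, K⟩ (hx : x ∉ (K : Set X))
  obtain ⟨U, V, hU, hV, hKU, hxV, hUV⟩ := K.isCompact.separation_of_notMem hx
  exact ⟨V ×ˢ {L : Subcontinua X | (L : Set X) ⊆ U},
    fun p hp hmem => hUV.notMem_of_mem_left (hp.2 hmem) hp.1,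
    hV.prod (isOpen_subset hU), hxV, hKU⟩

theorem isClosed_setOf_mem [T2Space X] (x : X) : IsClosed {K : Subcontinua X | x ∈ K} :=
  isClosed_mem.preimage (Continuous.prodMk_right x)

theorem isClosed_subset [T2Space X] :
    IsClosed {p : Subcontinua X × Subcontinua X | (p.1 : Set X) ⊆ p.2} := by
  rw [← isOpen_compl_iff, isOpen_iff_forall_mem_open]
  rintro ⟨K, L⟩ (h : ¬ (K : Set X) ⊆ L)
  obtain ⟨x, hxK, hxL⟩ := not_subset.1 h
  obtain ⟨U, V, hU, hV, hLU, hxV, hUV⟩ := L.isCompact.separation_of_notMem hxL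
  refine ⟨{K' : Subcontinua X | ((K' : Set X) ∩ V).Nonempty} ×ˢ
      {L' : Subcontinua X | (L' : Set X) ⊆ U}, ?_,
    (isOpen_inter_nonempty hV).prod (isOpen_subset hU), ⟨x, hxK, hxV⟩, hLU⟩
  rintro ⟨K', L'⟩ ⟨⟨y, hyK, hyV⟩, hL'⟩ hsub
  exact hUV.notMem_of_mem_left (hL' (hsub hyK)) hyV

/-- A nonempty closed chain of subcontinua has a least element. -/
theorem exists_least_of_isClosed [T2Space X] [CompactSpace X] {G : Set (Subcontinua X)}
    (hG : IsClosed G) (hne : G.Nonempty)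
    (hch : ∀ K ∈ G, ∀ L ∈ G, (K : Set X) ⊆ L ∨ (L : Set X) ⊆ K) :
    ∃ B ∈ G, ∀ K ∈ G, (B : Set X) ⊆ K := by
  have := hne.to_subtype
  have hcl (K : G) : IsClosed (G ∩ {L | (L : Set X) ⊆ K.1}) :=
    hG.inter (isClosed_subset.preimage (Continuous.prodMk_left K.1))
  obtain ⟨B, hB⟩ := IsCompact.nonempty_iInter_of_directed_nonempty_isCompact_isClosed
    (fun K : G => G ∩ {L | (L : Set X) ⊆ K.1})
    (fun K L => (hch K K.2 L L.2).elim
      (fun h => ⟨K, fun _ h' => h', fun M hM => ⟨hM.1, hM.2.trans h⟩⟩)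
      (fun h => ⟨L, fun M hM => ⟨hM.1, hM.2.trans h⟩, fun _ h' => h'⟩))
    (fun K => ⟨K, K.2, Subset.rfl⟩) (fun K => (hcl K).isCompact) hcl
  rw [mem_iInter] at hB
  exact ⟨B, (hB (Classical.arbitrary G)).1, fun K hK => (hB ⟨K, hK⟩).2⟩

/-- A nonempty closed chain of subcontinua has a greatest element. -/
theorem exists_greatest_of_isClosed [T2Space X] [CompactSpace X] {G : Set (Subcontinua X)}
    (hG : IsClosed G) (hne : G.Nonempty)
    (hch : ∀ K ∈ G, ∀ L ∈ G, (K : Set X) ⊆ L ∨ (L : Set X) ⊆ K) :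
    ∃ B ∈ G, ∀ K ∈ G, (K : Set X) ⊆ B := by
  have := hne.to_subtype
  have hcl (K : G) : IsClosed (G ∩ {L | (K.1 : Set X) ⊆ L}) :=
    hG.inter (isClosed_subset.preimage (Continuous.prodMk_right K.1))
  obtain ⟨B, hB⟩ := IsCompact.nonempty_iInter_of_directed_nonempty_isCompact_isClosed
    (fun K : G => G ∩ {L | (K.1 : Set X) ⊆ L})
    (fun K L => (hch K K.2 L L.2).elim
      (fun h => ⟨L, fun M hM => ⟨hM.1, h.trans hM.2⟩, fun _ h' => h'⟩)
      (fun h => ⟨K, fun _ h' => h', fun M hM => ⟨hM.1, h.trans hM.2⟩⟩))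
    (fun K => ⟨K, K.2, Subset.rfl⟩) (fun K => (hcl K).isCompact) hcl
  rw [mem_iInter] at hB
  exact ⟨B, (hB (Classical.arbitrary G)).1, fun K hK => (hB ⟨K, hK⟩).2⟩

/-- Boundary bumping: between nested distinct subcontinua there is a third one. -/
theorem exists_between [T2Space X] {A B : Subcontinua X} (hAB : (A : Set X) ⊂ B) :
    ∃ C : Subcontinua X, (A : Set X) ⊂ C ∧ (C : Set X) ⊂ B := by
  obtain ⟨b, hbB, hbA⟩ := exists_of_ssubset hAB
  obtain ⟨a, haA⟩ := A.isConnected.nonempty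
  obtain ⟨U, V, hU, hV, hAU, hbV, hUV⟩ := A.isCompact.separation_of_notMem hbA
  set N : Set X := (B : Set X) \ V with hN
  have hNc : IsCompact N := B.isCompact.diff hV
  have hUN : (B : Set X) ∩ U ⊆ N := fun x hx => ⟨hx.1, hUV.notMem_of_mem_left hx.2⟩
  have hAN : (A : Set X) ⊆ N := fun x hx => hUN ⟨hAB.1 hx, hAU hx⟩
  have haN : a ∈ N := hAN haA
  have : CompactSpace N := isCompact_iff_compactSpace.1 hNc
  have hC : connectedComponentIn N a = Subtype.val '' connectedComponent (⟨a, haN⟩ : N) :=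
    connectedComponentIn_eq_image haN
  let C : Subcontinua X := mk' (connectedComponentIn N a)
    (hC ▸ isClosed_connectedComponent.isCompact.image continuous_subtype_val)
    (isConnected_connectedComponentIn_iff.2 haN)
  have hCN : (C : Set X) ⊆ N := connectedComponentIn_subset N a
  have hAC : (A : Set X) ⊆ C := A.isConnected.isPreconnected.subset_connectedComponentIn haA hAN
  refine ⟨C, hAC.ssubset_of_not_subset fun hCA => ?_,
    (hCN.trans sdiff_subset).ssubset_of_not_subset fun h => (hCN (h hbB)).2 hbV⟩
  -- If the component of `a` in `N` stays inside `A ⊆ U`, compactness yields a clopen piece `Z` of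
  -- `N` within `U`. As `B ∩ U ⊆ N`, this `Z` is also clopen in `B` and misses `b`, contradicting
  -- connectedness of `B`.
  obtain ⟨Z, hZ, haZ, hZU⟩ : ∃ Z : Set N, IsClopen Z ∧ ⟨a, haN⟩ ∈ Z ∧
      Z ⊆ Subtype.val ⁻¹' U := by
    have hsub : (⋂ s : { s : Set N // IsClopen s ∧ ⟨a, haN⟩ ∈ s }, s.1) ⊆ Subtype.val ⁻¹' U := by
      rw [← connectedComponent_eq_iInter_isClopen]
      intro y hy
      exact hAU (hCA (show y.1 ∈ connectedComponentIn N a from hC ▸ mem_image_of_mem _ hy))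
    have : Nonempty { s : Set N // IsClopen s ∧ ⟨a, haN⟩ ∈ s } :=
      ⟨⟨univ, isClopen_univ, mem_univ _⟩⟩
    obtain ⟨Z, hZ⟩ := exists_subset_nhds_of_isCompact
      (V := fun s : { s : Set N // IsClopen s ∧ ⟨a, haN⟩ ∈ s } => s.1)
      (fun s t => ⟨⟨s.1 ∩ t.1, s.2.1.inter t.2.1, s.2.2, t.2.2⟩, inter_subset_left,
        inter_subset_right⟩)
      (fun s => s.2.1.isClosed.isCompact)
      (fun x hx => (hU.preimage continuous_subtype_val).mem_nhds (hsub hx))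
    exact ⟨Z.1, Z.2.1, Z.2.2, hZ⟩
  obtain ⟨W, hW, rfl⟩ := isOpen_induced_iff.1 hZ.isOpen
  have hZc : IsClosed (Subtype.val '' (Subtype.val ⁻¹' W : Set N)) :=
    (hZ.isClosed.isCompact.image continuous_subtype_val).isClosed
  obtain ⟨y, hyB, ⟨hyW, hyU⟩, hyZ⟩ := B.isConnected.isPreconnected (W ∩ U)
    (Subtype.val '' (Subtype.val ⁻¹' W : Set N))ᶜ (hW.inter hU) hZc.isOpen_compl
    (fun y _ => by
      by_cases hy : y ∈ Subtype.val '' (Subtype.val ⁻¹' W : Set N)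
      · obtain ⟨z, hz, rfl⟩ := hy
        exact Or.inl ⟨hz, hZU hz⟩
      · exact Or.inr hy)
    ⟨a, hAB.1 haA, haZ, hAU haA⟩
    ⟨b, hbB, by rintro ⟨z, -, rfl⟩; exact z.2.2 hbV⟩
  exact hyZ ⟨⟨y, hUN ⟨hyB, hyU⟩⟩, hyW, rfl⟩

end Subcontinua

open Subcontinua

/-! ### Maximal order arcs in a hereditarily indecomposable continuum -/

section

variable {X : Type*} [TopologicalSpace X]

/-- In a hereditarily indecomposable continuum, subcontinua that meet are comparable. -/
theorem IsHereditarilyIndecomposable.subset_or_subset (hX : IsHereditarilyIndecomposable X)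
    {K L : Subcontinua X} {x : X} (hK : x ∈ K) (hL : x ∈ L) :
    (K : Set X) ⊆ L ∨ (L : Set X) ⊆ K := by
  by_contra! h
  let M : Subcontinua X := mk' ((K : Set X) ∪ L) (K.isCompact.union L.isCompact)
    (K.isConnected.union ⟨x, hK, hL⟩ L.isConnected)
  exact hX M ⟨K, L, subset_union_left.ssubset_of_not_subset
      fun hs => h.2 (subset_union_right.trans hs),
    subset_union_right.ssubset_of_not_subset fun hs => h.1 (subset_union_left.trans hs), rfl⟩

/-- A separation of this closed chain would leave a gap between two consecutive members, which
`exists_between` forbids. -/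
theorem IsHereditarilyIndecomposable.isConnected_setOf_mem [T2Space X] [CompactSpace X]
    [ConnectedSpace X] (hX : IsHereditarilyIndecomposable X) (x : X) :
    IsConnected {K : Subcontinua X | x ∈ K} := by
  have hx : x ∈ single x := rfl
  refine ⟨⟨single x, hx⟩, ?_⟩
  rw [isPreconnected_iff_subset_of_fully_disjoint_closed (isClosed_setOf_mem x)]
  intro F G hF hG hFG hd
  wlog hxF : single x ∈ F generalizing F G
  · exact (this G F hG hF (union_comm F G ▸ hFG) hd.symm
      ((hFG hx).resolve_left hxF)).symm
  left
  by_contra hne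
  obtain ⟨K, hxK, hKF⟩ := not_subset.1 hne
  obtain ⟨B, ⟨hBG, hxB⟩, hB⟩ := exists_least_of_isClosed (hG.inter (isClosed_setOf_mem x))
    ⟨K, (hFG hxK).resolve_left hKF, hxK⟩ (fun K hK L hL => hX.subset_or_subset hK.2 hL.2)
  -- `A` is the last member of `F` below `B`, the first member of `G`: nothing strictly between them
  -- can lie in `F` or in `G`.
  obtain ⟨A, ⟨⟨hAF, hxA⟩, hAB⟩, hA⟩ := exists_greatest_of_isClosed
    ((hF.inter (isClosed_setOf_mem x)).inter
      (isClosed_subset.preimage (Continuous.prodMk_left B)))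
    ⟨single x, ⟨hxF, hx⟩, singleton_subset_iff.2 hxB⟩
    (fun K hK L hL => hX.subset_or_subset hK.1.2 hL.1.2)
  have hAB' : (A : Set X) ⊂ B := lt_of_le_of_ne hAB fun h =>
    hd.notMem_of_mem_left hAF (SetLike.coe_injective h ▸ hBG)
  obtain ⟨C, hAC, hCB⟩ := exists_between hAB'
  have hxC : x ∈ C := hAC.1 hxA
  rcases hFG hxC with hC | hC
  · exact hAC.2 (hA C ⟨⟨hC, hxC⟩, hCB.1⟩)
  · exact hCB.2 (hB C ⟨hC, hxC⟩)

theorem isClosed_setOf_isOrderArc [T2Space X] :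
    IsClosed {𝒞 : Subcontinua (Subcontinua X) | IsOrderArc 𝒞} := by
  rw [← isOpen_compl_iff, isOpen_iff_forall_mem_open]
  intro 𝒞 (h𝒞 : ¬ IsOrderArc 𝒞)
  unfold IsOrderArc at h𝒞
  push Not at h𝒞
  obtain ⟨K, hK, L, hL, hKL, hLK⟩ := h𝒞
  have ho : IsOpen {p : Subcontinua X × Subcontinua X |
      ¬ (p.1 : Set X) ⊆ p.2 ∧ ¬ (p.2 : Set X) ⊆ p.1} :=
    isClosed_subset.isOpen_compl.inter (isClosed_subset.preimage continuous_swap).isOpen_compl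
  obtain ⟨U, V, hU, hV, hKU, hLV, hUV⟩ := isOpen_prod_iff.1 ho K L ⟨hKL, hLK⟩
  refine ⟨{𝒟 | ((𝒟 : Set (Subcontinua X)) ∩ U).Nonempty} ∩
      {𝒟 | ((𝒟 : Set (Subcontinua X)) ∩ V).Nonempty}, ?_,
    (isOpen_inter_nonempty hU).inter (isOpen_inter_nonempty hV), ⟨K, hK, hKU⟩, ⟨L, hL, hLV⟩⟩
  rintro 𝒟 ⟨⟨K', hK', hKU'⟩, ⟨L', hL', hLV'⟩⟩ h𝒟
  have := @hUV (K', L') ⟨hKU', hLV'⟩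
  exact (h𝒟 K' hK' L' hL').elim this.1 this.2

/-- An order arc from `{x}` to `X` contains every subcontinuum through `x`. -/
theorem IsOrderArc.coe_eq [T2Space X] (hX : IsHereditarilyIndecomposable X)
    {𝒞 : Subcontinua (Subcontinua X)} (h𝒞 : IsOrderArc 𝒞) {T : Subcontinua X} (hT : T ∈ 𝒞)
    (hT' : (T : Set X) = univ) {x : X} (hx : single x ∈ 𝒞) :
    (𝒞 : Set (Subcontinua X)) = {K | x ∈ K} := by
  have hmem : ∀ K ∈ 𝒞, x ∈ K := by
    intro K hK
    rcases h𝒞 _ hx K hK with h | h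
    · exact h rfl
    · obtain ⟨y, hy⟩ := K.isConnected.nonempty
      exact (mem_singleton_iff.1 (h hy)) ▸ hy
  refine Subset.antisymm hmem fun K hK => ?_
  -- The members below `K` and those above `K` are closed and cover the connected `𝒞`; a common
  -- member can only be `K`.
  obtain ⟨L, hL, hLK, hKL⟩ := isPreconnected_closed_iff.1 𝒞.isConnected.isPreconnected
    {L | (L : Set X) ⊆ K} {L | (K : Set X) ⊆ L}
    (isClosed_subset.preimage (Continuous.prodMk_left K))
    (isClosed_subset.preimage (Continuous.prodMk_right K))
    (fun L hL => hX.subset_or_subset (hmem L hL) hK)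
    ⟨_, hx, singleton_subset_iff.2 hK⟩ ⟨T, hT, (subset_univ _).trans hT'.ge⟩
  exact (SetLike.coe_injective (Subset.antisymm hLK hKL) : L = K) ▸ hL

theorem MOA.isOpen_inter_nonempty {V : Set (Subcontinua X)} (hV : IsOpen V) :
    IsOpen {𝒞 : MOA X | ((𝒞 : Set (Subcontinua X)) ∩ V).Nonempty} :=
  (Subcontinua.isOpen_inter_nonempty hV).preimage continuous_subtype_val

variable [T2Space X] [CompactSpace X] [ConnectedSpace X]

/-- The maximal order arc of all subcontinua containing `x`. -/
def MOA.through (hX : IsHereditarilyIndecomposable X) (x : X) : MOA X :=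
  ⟨mk' {K | x ∈ K} (isClosed_setOf_mem x).isCompact (hX.isConnected_setOf_mem x),
    fun _ h₁ _ h₂ => hX.subset_or_subset h₁ h₂,
    ⟨mk' univ isCompact_univ isConnected_univ, mem_univ x, rfl⟩, x, single x, rfl, rfl⟩

theorem MOA.exists_eq_through (hX : IsHereditarilyIndecomposable X) (𝒞 : MOA X) :
    ∃ x, 𝒞 = MOA.through hX x := by
  obtain ⟨h, ⟨T, hT, hT'⟩, x, S, hS, hS'⟩ := 𝒞.2
  obtain rfl : S = single x := SetLike.coe_injective hS'
  exact ⟨x, SetLike.coe_injective (h.coe_eq hX hT hT' hS)⟩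

/-- By `IsOrderArc.coe_eq` the graph is cut out by closed conditions, and a closed graph in a
compact space gives continuity. -/
theorem MOA.continuous_through (hX : IsHereditarilyIndecomposable X) :
    Continuous (MOA.through hX) := by
  let T : Subcontinua X := mk' univ isCompact_univ isConnected_univ
  have hgraph : IsClosed {p : X × Subcontinua (Subcontinua X) |
      IsOrderArc p.2 ∧ T ∈ p.2 ∧ single p.1 ∈ p.2} :=
    (isClosed_setOf_isOrderArc.preimage continuous_snd).inter
      (((isClosed_setOf_mem T).preimage continuous_snd).inter
        (isClosed_mem.preimage (continuous_single.prodMap continuous_id)))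
  refine Continuous.subtype_mk (continuous_iff_isClosed.2 fun F hF => ?_) _
  convert isClosedMap_fst_of_compactSpace _ (hgraph.inter (hF.preimage continuous_snd))
  ext x
  constructor
  · intro hx
    exact ⟨(x, (MOA.through hX x).1), ⟨⟨(MOA.through hX x).2.1, mem_univ x, rfl⟩, hx⟩, rfl⟩
  · rintro ⟨⟨y, 𝒞⟩, ⟨⟨h₁, h₂, h₃⟩, h𝒞⟩, rfl⟩
    have : 𝒞 = (MOA.through hX y).1 := SetLike.coe_injective (h₁.coe_eq hX h₂ rfl h₃)
    exact this ▸ h𝒞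

/-- Near a maximal order arc and a member of it there are a maximal order arc and a member of it
belonging to a prescribed dense set. -/
theorem MOA.exists_mem_of_dense (hX : IsHereditarilyIndecomposable X) {O : Set (Subcontinua X)}
    (hO : Dense O) {𝒰 : Set (MOA X)} (h𝒰 : IsOpen 𝒰) {V : Set (Subcontinua X)} (hV : IsOpen V)
    {𝒞 : MOA X} (h𝒞 : 𝒞 ∈ 𝒰) {K : Subcontinua X} (hK : K ∈ 𝒞) (hKV : K ∈ V) :
    ∃ 𝒟 ∈ 𝒰, ∃ L ∈ 𝒟, L ∈ V ∩ O := by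
  obtain ⟨x, rfl⟩ := MOA.exists_eq_through hX 𝒞
  obtain ⟨L, ⟨hLV, y, hyL, hy⟩, hLO⟩ := hO.inter_open_nonempty _
    (hV.inter (Subcontinua.isOpen_inter_nonempty (h𝒰.preimage (MOA.continuous_through hX))))
    ⟨K, hKV, x, hK, h𝒞⟩
  exact ⟨MOA.through hX y, hy, L, hyL, hLV, hLO⟩

/-- The Kuratowski–Ulam argument: a dense open set of subcontinua meets generic maximal order arcs
in a dense set. -/
theorem MOA.eventually_residual_dense [SecondCountableTopology X]
    (hX : IsHereditarilyIndecomposable X) {O : Set (Subcontinua X)} (hOo : IsOpen O)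
    (hO : Dense O) :
    ∀ᶠ 𝒞 : MOA X in residual (MOA X), Dense {C : 𝒞 | C.1 ∈ O} := by
  have key : ∀ V ∈ countableBasis (Subcontinua X), ∀ᶠ 𝒞 : MOA X in residual (MOA X),
      ((𝒞 : Set (Subcontinua X)) ∩ V).Nonempty →
        ((𝒞 : Set (Subcontinua X)) ∩ (V ∩ O)).Nonempty := by
    intro V hVb
    have hV := isOpen_of_mem_countableBasis hVb
    let A : Set (MOA X) := {𝒞 | ((𝒞 : Set (Subcontinua X)) ∩ (V ∩ O)).Nonempty}
    have hA : IsOpen A := MOA.isOpen_inter_nonempty (hV.inter hOo)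
    -- A generic arc outside `A` avoids `closure A`; if it met `V`, density of `O` would give an arc
    -- of `A` in that open complement.
    have hres : A ∪ (closure A)ᶜ ∈ residual (MOA X) := by
      refine residual_of_dense_open (hA.union isClosed_closure.isOpen_compl) fun 𝒞 => ?_
      rw [closure_union]
      exact (em (𝒞 ∈ closure A)).imp id fun h => subset_closure h
    filter_upwards [hres] with 𝒞 h𝒞
    rintro ⟨K, hK, hKV⟩
    refine h𝒞.resolve_right fun hn => ?_
    obtain ⟨𝒟, h𝒟, L, hL, hLVO⟩ := MOA.exists_mem_of_dense hX hO
      isClosed_closure.isOpen_compl hV hn hK hKV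
    exact h𝒟 (subset_closure ⟨L, hL, hLVO⟩)
  filter_upwards [(eventually_countable_ball (countable_countableBasis _)).2 key] with 𝒞 h𝒞
  rw [dense_iff_inter_open]
  rintro _ ⟨W, hW, rfl⟩ ⟨C, hC⟩
  obtain ⟨V, hVb, hCV, hVW⟩ := (isBasis_countableBasis (Subcontinua X)).exists_subset_of_mem_open hC hW
  obtain ⟨L, hL, hLV, hLO⟩ := h𝒞 V hVb ⟨C, C.2, hCV⟩
  exact ⟨⟨L, hL⟩, hVW hLV, hLO⟩

end

theorem mainTheorem11 (X : Type*) [TopologicalSpace X] [CompactSpace X] [ConnectedSpace X]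
    [MetrizableSpace X] (hX : IsHereditarilyIndecomposable X) :
    (∀ O : Set (Subcontinua X), Dense O →
      Dense ((fun p : MOAIncidence X => p.1.2) ⁻¹' O)) ∧
    (GHEC X → GCGHEC X) := by
  let _ := metrizableSpaceMetric X
  refine ⟨fun O hO => ?_, fun h => ?_⟩
  · rw [dense_iff_inter_open]
    rintro _ ⟨W, hW, rfl⟩ ⟨⟨⟨𝒞, K⟩, hK⟩, hKW⟩
    obtain ⟨𝒰, V, h𝒰, hV, h𝒞, hKV, hsub⟩ := isOpen_prod_iff.1 hW 𝒞 K hKW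
    obtain ⟨𝒟, h𝒟, L, hL, hLV, hLO⟩ := MOA.exists_mem_of_dense hX hO h𝒰 hV h𝒞 hK hKV
    exact ⟨⟨(𝒟, L), hL⟩, hsub ⟨h𝒟, hLV⟩, hLO⟩
  · obtain ⟨S, hSo, hSd, hSc, hS⟩ := mem_residual_iff.1 h
    have key : ∀ᶠ 𝒞 : MOA X in residual (MOA X), ∀ O ∈ S, Dense {C : 𝒞 | C.1 ∈ O} :=
      (eventually_countable_ball hSc).2 fun O hO =>
        MOA.eventually_residual_dense hX (hSo O hO) (hSd O hO)
    refine mem_of_superset key fun 𝒞 h𝒞 => ?_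
    have hall : ∀ᶠ C : 𝒞 in residual 𝒞, ∀ O ∈ S, C.1 ∈ O :=
      (eventually_countable_ball hSc).2 fun O hO =>
        residual_of_dense_open ((hSo O hO).preimage continuous_subtype_val) (h𝒞 O hO)
    exact mem_of_superset hall fun C hC _ => hS hC
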